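/- **Setting.** Let $\Gamma$ be a finite connected graph (loops and multiple edges allowed) with a fixed orientation; an edge $e$ has source $s(e)$ and target $t(e)$. A divisor on $\Gamma$ is a function $V(\Gamma)\to\mathbb Z$. For $m\colon V(\Gamma)\to\mathbb Z$ let $\delta(m)(e)=m(t(e))-m(s(e))$, and for $\phi\colon E(\Gamma)\to\mathbb Z$ let $\partial(\phi)=\sum_e\phi(e)\,(t(e)-s(e))$; two divisors are equivalent if they differ by some $\partial\delta(m)$. For $W\subset V(\Gamma)$ let $\delta_W$ be the number of edges joining $W$ to its complement. Let $\mu\colon V(\Gamma)\to\mathbb R$ be a polarization of degree $k\in\mathbb Z$, i.e. $\sum_v\mu(v)=k$, and put $\mu(W)=\sum_{v\in W}\mu(v)$. Let $v_0\in V(\Gamma)$. A divisor $D$ of degree $k$ is $(v_0,\mu)$-quasistable if $\deg(D|_W)-\mu(W)+\delta_W/2\ge 0$ for every $W\subsetneq V(\Gamma)$, with strict inequality if $v_0\in W$. A divisor $D$ of degree $k$ is equivalent to a unique $(v_0,\mu)$-quasistable divisor $\mathrm{qs}(D)$; writing $D-\mathrm{qs}(D)=\partial\delta(m)$, let $\phi_D=\delta(m)$,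 which is uniquely determined by $D$. A pseudo-divisor $(\mathcal E,D)$ consists of $\mathcal E\subset E(\Gamma)$ and a divisor $D$ on the graph $\Gamma^{\mathcal E}$ obtained by inserting one exceptional vertex in each edge of $\mathcal E$, with $D=-1$ at every exceptional vertex; it is $(v_0,\mu)$-quasistable if $D$ is so on $\Gamma^{\mathcal E}$, with $\mu$ extended by $0$. Let $X=X_\Gamma$ be the tropical curve obtained from $\Gamma$ by giving every edge length $1$, and for $r\in[0,1]$ let $p_{e,r}$ be the point of $e$ at distance $r$ from $s(e)$. A divisor on $X$ is a finite integral combination of points. Two divisors are equivalent if they differ by $\mathrm{div}(f)$ for a continuous piecewise linear function $f\colon X\to\mathbb R$ with integer slopes, where $\mathrm{div}(f)$ has at $p$ the sum of the incoming slopes of $f$ at $p$ as coefficient; $[\cdot]$ denotes the class of a divisor. With $p_0\in X$ the point $v_0$, the Jacobian $J^{\mathrm{trop}}_{p_0,\mu}(X)$ is the set of classes of degree $k$. It is the disjoint union, over the $(v_0,\mu)$-quasistable pseudo-divisors $(\mathcal E,D)$, of the open cells $$\mathcal P^\circ_{(\mathcal E,D)}=\Big\{\Big[\sum_{v\in V(\Gamma)}D(v)\,v-\sum_{e\in\mathcal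 E}p_{e,x_e}\Big] : x_e\in(0,1)\text{ for all } e\in\mathcal E\Big\}.$$ Let $d\ge0$, let $D^\dagger$ be a divisor on $\Gamma$ of degree $k+d$, let $\mathcal D^\dagger$ be the divisor it induces on $X$, and let $\alpha^{\mathrm{trop}}_{d,\mathcal D^\dagger}\colon X^d\to J^{\mathrm{trop}}_{p_0,\mu}(X)$ be the map $(p_1,\dots,p_d)\mapsto[\mathcal D^\dagger-\sum_i p_i]$. Let $f\colon\{1,\dots,d\}\to E(\Gamma)$ be a function and $\mathcal H_f=\prod_k f(k)\cong[0,1]^d$ the corresponding box in $X^d$. For a vertex $Q$ of $\mathcal H_f$ let $\delta_k(Q)\in\{s(f(k)),t(f(k))\}$ be its $k$-th coordinate and $\mathrm{div}(Q)=-\sum_k\delta_k(Q)$. For an edge $e$, a vertex $v$ and $W\subset V(\Gamma)$ put $$a^e_Q(v)=\#\{k : f(k)=e,\ \delta_k(Q)=v\},\qquad a^e_Q(W)=\#\{k : f(k)=e,\ \delta_k(Q)\notin W\},\qquad b^e_Q(D^\dagger)=\phi_{D^\dagger+\mathrm{div}(Q)}(e),$$ and let $b^e_Q(W,D^\dagger)$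 be $b^e_Q(D^\dagger)$ if $t(e)\in W$, $s(e)\notin W$; $-b^e_Q(D^\dagger)$ if $t(e)\notin W$, $s(e)\in W$; and $0$ otherwise. **Theorem.** Let $n\ge 0$, let $S=\{Q_0,\dots,Q_n\}$ be a set of vertices of $\mathcal H_f$, and let $\mathrm{Conv}(S)^\circ$ be the relative interior of the convex hull of $S$ in $\mathcal H_f\cong[0,1]^d$. Suppose that $\alpha^{\mathrm{trop}}_{d,\mathcal D^\dagger}(\mathrm{Conv}(S)^\circ)\subset\mathcal P^\circ_{(\mathcal E,D)}$ for some $(v_0,\mu)$-quasistable pseudo-divisor $(\mathcal E,D)$ on $\Gamma$. Then: 1. for all $i,j\in\{0,\dots,n\}$ and every $e\in E(\Gamma)$, $$\Big|\big(a^e_{Q_i}(t(e))+b^e_{Q_i}(D^\dagger)\big)-\big(a^e_{Q_j}(t(e))+b^e_{Q_j}(D^\dagger)\big)\Big|\le 1;$$ 2. for every function $j\colon E(\Gamma)\to\{0,\dots,n\}$ and every proper subset $W\subsetneq V(\Gamma)$ with $v_0\in W$, $$-\frac{\delta_W}{2}<\deg(D^\dagger|_W)-\mu(W)-d+\sum_{e\in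 E(\Gamma)}\big(a^e_{Q_{j(e)}}(W)-b^e_{Q_{j(e)}}(W,D^\dagger)\big)\le\frac{\delta_W}{2}.$$ -/

import Mathlib

open Finset

/-- A graph with a fixed orientation: vertex set `V`, edge set `E`, and for each edge its source
and target.  Loops and multiple edges are allowed. -/
structure OrientedGraph (V E : Type*) where
  /-- the source `s(e)` -/
  src : E → V
  /-- the target `t(e)` -/
  tgt : E → V

namespace OrientedGraph

noncomputable section

section Graphs

variable {V E : Type*} (Γ : OrientedGraph V E)

/-- Connectedness of the underlying unoriented graph. -/
def Connected : Prop :=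
  Nonempty V ∧ ∀ u v : V, Relation.EqvGen (fun a b => ∃ e, Γ.src e = a ∧ Γ.tgt e = b) u v

/-- The differential `δ(M)` of a 0-chain `M = ∑ m_v v`, i.e. `δ(M)(e) = m_{t(e)} - m_{s(e)}`. -/
def diff (m : V → ℤ) : E → ℤ := fun e => m (Γ.tgt e) - m (Γ.src e)

/-- The boundary `∂(φ)`, with `∂(e) = t(e) - s(e)`; this is the divisor of the flow `φ`. -/
def bdry [DecidableEq V] [Fintype E] (φ : E → ℤ) : V → ℤ := fun v =>
  (∑ e with Γ.tgt e = v, φ e) - ∑ e with Γ.src e = v, φ e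

/-- `δ_W`: the number of edges joining a vertex of `W` to a vertex outside `W`. -/
def cut [DecidableEq V] [Fintype E] (W : Finset V) : ℕ :=
  #{e : E | ¬ (Γ.src e ∈ W ↔ Γ.tgt e ∈ W)}

/-- `β_D(W) = deg(D|_W) - μ(W) + δ_W / 2`. -/
def beta [DecidableEq V] [Fintype E] (μ : V → ℝ) (D : V → ℤ) (W : Finset V) : ℝ :=
  (∑ v ∈ W, (D v : ℝ)) - (∑ v ∈ W, μ v) + (Γ.cut W : ℝ) / 2

/-- `D` is `(v₀, μ)`-quasistable: it has the degree of `μ`, and `β_D(W) ≥ 0` for every proper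
subset `W` of the vertex set, with strict inequality if `v₀ ∈ W`. -/
def IsQuasistable [Fintype V] [DecidableEq V] [Fintype E] (v₀ : V) (μ : V → ℝ) (D : V → ℤ) :
    Prop :=
  (∑ v, (D v : ℝ)) = ∑ v, μ v ∧
    ∀ W : Finset V, W ≠ univ → 0 ≤ Γ.beta μ D W ∧ (v₀ ∈ W → 0 < Γ.beta μ D W)

open Classical in
/-- The flow `φ_D = δ(M_D)`, where `M_D` is a 0-chain such that `D - ∂δ(M_D)` is the
`(v₀, μ)`-quasistable divisor `qs(D)` equivalent to `D`.  On a connected graph, and for `D` of the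
degree of `μ`, such a chain exists, and `φ_D` does not depend on its choice. -/
def qsFlow [Fintype V] [DecidableEq V] [Fintype E] (v₀ : V) (μ : V → ℝ) (D : V → ℤ) :
    E → ℤ :=
  if h : ∃ m : V → ℤ, Γ.IsQuasistable v₀ μ (D - Γ.bdry (Γ.diff m)) then Γ.diff h.choose else 0

/-- The subdivision `Γ^𝓔`: one exceptional vertex (`Sum.inr e`) is added in the interior of every
edge `e ∈ 𝓔`, which is thus replaced by the edges `(e, false)` from `s(e)` to the exceptional
vertex and `(e, true)` from the exceptional vertex to `t(e)`. -/
def subdivision (𝓔 : Finset E) :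
    OrientedGraph (V ⊕ {e // e ∈ 𝓔}) ({e // e ∉ 𝓔} ⊕ {e // e ∈ 𝓔} × Bool) where
  src
    | Sum.inl e => Sum.inl (Γ.src e.1)
    | Sum.inr (e, false) => Sum.inl (Γ.src e.1)
    | Sum.inr (e, true) => Sum.inr e
  tgt
    | Sum.inl e => Sum.inl (Γ.tgt e.1)
    | Sum.inr (e, false) => Sum.inr e
    | Sum.inr (e, true) => Sum.inl (Γ.tgt e.1)

/-- A pseudo-divisor `(𝓔, D)`: a set `𝓔` of edges and a divisor `D` on `Γ^𝓔` with value `-1` at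
every exceptional vertex. -/
structure PseudoDivisor (Γ : OrientedGraph V E) where
  /-- the set of edges -/
  edges : Finset E
  /-- the divisor on the subdivision -/
  D : V ⊕ {e // e ∈ edges} → ℤ
  exceptional : ∀ e, D (Sum.inr e) = -1

/-- `(𝓔, D)` is `(v₀, μ)`-quasistable: `D` is quasistable on `Γ^𝓔` with respect to the
polarization `μ` extended by `0` to the exceptional vertices. -/
def PseudoDivisor.IsQuasistable {Γ : OrientedGraph V E} [Fintype V] [DecidableEq V] [Fintype E]
    [DecidableEq E] (P : Γ.PseudoDivisor) (v₀ : V) (μ : V → ℝ) : Prop :=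
  (Γ.subdivision P.edges).IsQuasistable (Sum.inl v₀) (Sum.elim μ fun _ => 0) P.D

end Graphs

section TropicalCurve

variable {V E : Type*}

/-- The points of the tropical curve `X_Γ` all of whose edges have length 1: the vertices and the
interior points of the edges.  The gluing is expressed by `OrientedGraph.pt`. -/
inductive Point (Γ : OrientedGraph V E)
  | vertex (v : V) : Point Γ
  | inner (e : E) (x : Set.Ioo (0 : ℝ) 1) : Point Γ

variable (Γ : OrientedGraph V E)

/-- The point `p_{e,r}` on the edge `e` at distance `r ∈ [0,1]` from the source of `e`; so
`p_{e,0} = s(e)` and `p_{e,1} = t(e)`. -/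
def pt (e : E) (r : ℝ) : Γ.Point :=
  if h : 0 < r ∧ r < 1 then .inner e ⟨r, h⟩
  else if r ≤ 0 then .vertex (Γ.src e) else .vertex (Γ.tgt e)

/-- A rational function on `X_Γ`: a continuous piecewise linear function with integer slopes.
It is given with its one-sided slopes, both with respect to the orientation of the edge:
`slopeL e x` just before and `slopeR e x` just after the point `p_{e,x}`.  Having integer one-sided
slopes at all points of the compact interval `[0,1]` means exactly being continuous and piecewise
linear with finitely many pieces and integer slopes. -/
structure RatFun where
  toFun : Γ.Point → ℝ
  slopeL : E → ℝ → ℤ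
  slopeR : E → ℝ → ℤ
  eq_left : ∀ e, ∀ x ∈ Set.Ioc (0 : ℝ) 1, ∀ᶠ y in nhdsWithin x (Set.Iio x),
    toFun (Γ.pt e y) = toFun (Γ.pt e x) + slopeL e x * (y - x)
  eq_right : ∀ e, ∀ x ∈ Set.Ico (0 : ℝ) 1, ∀ᶠ y in nhdsWithin x (Set.Ioi x),
    toFun (Γ.pt e y) = toFun (Γ.pt e x) + slopeR e x * (y - x)

/-- `ord_p(f)`: the sum of the incoming slopes of `f` at `p`. -/
def RatFun.ord {Γ : OrientedGraph V E} [DecidableEq V] [Fintype E] (f : Γ.RatFun) : Γ.Point → ℤ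
  | .vertex v => (∑ e with Γ.tgt e = v, f.slopeL e 1) - ∑ e with Γ.src e = v, f.slopeR e 0
  | .inner e x => f.slopeL e x - f.slopeR e x

/-- The group `Prin(X_Γ)` of principal divisors, in the group `Γ.Point →₀ ℤ` of divisors. -/
def prin [DecidableEq V] [Fintype E] : AddSubgroup (Γ.Point →₀ ℤ) where
  carrier := {D | ∃ f : Γ.RatFun, ∀ p, D p = f.ord p}
  zero_mem' := by
    refine ⟨⟨fun _ => 0, fun _ _ => 0, fun _ _ => 0, ?_, ?_⟩, ?_⟩
    · intro e x _; simp
    · intro e x _; simp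
    · rintro (v | ⟨e, x⟩) <;> simp [RatFun.ord]
  add_mem' := by
    rintro D D' ⟨f, hf⟩ ⟨g, hg⟩
    refine ⟨⟨fun p => f.toFun p + g.toFun p, fun e x => f.slopeL e x + g.slopeL e x,
      fun e x => f.slopeR e x + g.slopeR e x, ?_, ?_⟩, ?_⟩
    · intro e x hx
      filter_upwards [f.eq_left e x hx, g.eq_left e x hx] with y h1 h2
      rw [h1, h2]; push_cast; ring
    · intro e x hx
      filter_upwards [f.eq_right e x hx, g.eq_right e x hx] with y h1 h2
      rw [h1, h2]; push_cast; ring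
    · rintro (v | ⟨e, x⟩) <;> rw [Finsupp.add_apply, hf, hg] <;>
        simp only [RatFun.ord, Finset.sum_add_distrib] <;> ring
  neg_mem' := by
    rintro D ⟨f, hf⟩
    refine ⟨⟨fun p => - f.toFun p, fun e x => - f.slopeL e x, fun e x => - f.slopeR e x,
      ?_, ?_⟩, ?_⟩
    · intro e x hx
      filter_upwards [f.eq_left e x hx] with y h1
      rw [h1]; push_cast; ring
    · intro e x hx
      filter_upwards [f.eq_right e x hx] with y h1
      rw [h1]; push_cast; ring
    · rintro (v | ⟨e, x⟩) <;> rw [Finsupp.neg_apply, hf] <;>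
        simp only [RatFun.ord, Finset.sum_neg_distrib] <;> ring

/-- The Picard group `Pic(X_Γ) = Div(X_Γ) / Prin(X_Γ)`. -/
abbrev Pic [DecidableEq V] [Fintype E] : Type _ := (Γ.Point →₀ ℤ) ⧸ Γ.prin

/-- A divisor on `Γ`, seen as a divisor on `X_Γ`. -/
def divisorOnCurve [Fintype V] (D : V → ℤ) : Γ.Point →₀ ℤ :=
  ∑ v, Finsupp.single (Point.vertex v) (D v)

/-- The divisor on `X_Γ` given by the pseudo-divisor `(𝓔, D)` and the point `(x_e)` of
`P_{(𝓔,D)} = ∏_{e ∈ 𝓔} e`: the value of `D` at the exceptional vertex over `e ∈ 𝓔` is placed at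
`p_{e,x_e}`. -/
def PseudoDivisor.divisorAt {Γ : OrientedGraph V E} [Fintype V]
    (P : Γ.PseudoDivisor) (x : {e // e ∈ P.edges} → ℝ) : Γ.Point →₀ ℤ :=
  Γ.divisorOnCurve (fun v => P.D (Sum.inl v)) +
    ∑ e : {e // e ∈ P.edges}, Finsupp.single (Γ.pt e.1 (x e)) (P.D (Sum.inr e))

/-- The open cell `P°_{(𝓔,D)} = ∏_{e ∈ 𝓔} e°` of a (quasistable) pseudo-divisor.  Each class of the
degree of `μ` has exactly one `(p₀, μ)`-quasistable representative, and `P°_{(𝓔,D)}` parametrizes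
the quasistable divisors inducing `(𝓔, D)`; so the tropical Jacobian `∐ P°_{(𝓔,D)}` is the set of
these classes and the open cell is a subset of `Pic(X_Γ)`. -/
def PseudoDivisor.openCell {Γ : OrientedGraph V E} [Fintype V] [DecidableEq V] [Fintype E]
    (P : Γ.PseudoDivisor) : Set Γ.Pic :=
  {c | ∃ x : {e // e ∈ P.edges} → ℝ, (∀ e, x e ∈ Set.Ioo (0 : ℝ) 1) ∧
    c = QuotientAddGroup.mk (P.divisorAt x)}

/-- The tropical Abel map `(p_1, …, p_d) ↦ [𝒟† - ∑ p_i]`. -/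
def tropAbel [Fintype V] [DecidableEq V] [Fintype E] (Ddag : V → ℤ) {d : ℕ}
    (p : Fin d → Γ.Point) : Γ.Pic :=
  QuotientAddGroup.mk (Γ.divisorOnCurve Ddag - ∑ i, Finsupp.single (p i) 1)

end TropicalCurve

section Box

variable {V E : Type*} (Γ : OrientedGraph V E) {d : ℕ} (f : Fin d → E)

/-- The point of `X_Γ^d` with coordinates `y ∈ [0,1]^d` in the box `H_f = f(1) × ⋯ × f(d)`. -/
def boxPoint (y : Fin d → ℝ) : Fin d → Γ.Point := fun k => Γ.pt (f k) (y k)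

/-- The vertices of `H_f ≅ [0,1]^d` are encoded by `Q : Fin d → Bool`, with `true` for the target
and `false` for the source of `f(k)`.  These are the coordinates of `Q` in `[0,1]^d`. -/
def vertexCoord (Q : Fin d → Bool) : Fin d → ℝ := fun k => if Q k then 1 else 0

/-- The vertex `δ_k(Q)` of `Γ` that is the `k`-th coordinate of the vertex `Q` of `H_f`. -/
def corner (Q : Fin d → Bool) (k : Fin d) : V := if Q k then Γ.tgt (f k) else Γ.src (f k)

/-- The divisor `div(Q) = -∑_k δ_k(Q)` on `Γ`. -/
def divOf [DecidableEq V] (Q : Fin d → Bool) : V → ℤ := fun v => -(#{k | Γ.corner f Q k = v} : ℤ)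

/-- `a^e_Q(v)`. -/
def aNum [DecidableEq V] [DecidableEq E] (Q : Fin d → Bool) (e : E) (v : V) : ℕ :=
  #{k | f k = e ∧ Γ.corner f Q k = v}

/-- `a^e_Q(W)`. -/
def aSet [DecidableEq V] [DecidableEq E] (Q : Fin d → Bool) (e : E) (W : Finset V) : ℕ :=
  #{k | f k = e ∧ Γ.corner f Q k ∉ W}

/-- `b^e_Q(D†)`. -/
def bNum [Fintype V] [DecidableEq V] [Fintype E] (v₀ : V) (μ : V → ℝ) (Ddag : V → ℤ)
    (Q : Fin d → Bool) (e : E) : ℤ :=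
  Γ.qsFlow v₀ μ (Ddag + Γ.divOf f Q) e

/-- `b^e_Q(W, D†)`. -/
def bSet [Fintype V] [DecidableEq V] [Fintype E] (v₀ : V) (μ : V → ℝ) (Ddag : V → ℤ)
    (Q : Fin d → Bool) (e : E) (W : Finset V) : ℤ :=
  if Γ.tgt e ∈ W ∧ Γ.src e ∉ W then Γ.bNum f v₀ μ Ddag Q e
  else if Γ.tgt e ∉ W ∧ Γ.src e ∈ W then -Γ.bNum f v₀ μ Ddag Q e
  else 0

end Box

end

end OrientedGraph

/-! For a point `y` of the box, lying over the open cell means that some rational function has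
divisor `D†` minus the points of `y` minus the pseudo-divisor placed at some `x`. Once points of `y`
at the end of an edge are counted as interior, its slopes at the sources form an integral flow `ψ`
(`IsFlow`), and its increments along the edges, a real coboundary, are explicit in `ψ`, `x`, `y`
(`exists_flow_of_tropAbel_mem`). The flow is determined by `y`: two candidates differ by a
circulation, which is orthogonal to coboundaries, while `n (n + r) > 0` for an integer `n ≠ 0` and
`|r| < 1` (`IsFlow.eq_of_increment`). Only finitely many flows occur, each on a closed set of `y`
once `x` may lie in the closed cube. So the flow is constant along the segment from a relative
interior point to any vertex `Q` of `S`, and survives in the limit at `Q`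
(`IsFlow.exists_increment_of_path`).

At `Q`, the floor of the real potential is an integral chain that moves `D† + div(Q)` to a divisor
obtained from `D` by sliding each exceptional vertex to an end of its edge. Such a divisor is
quasistable (`PseudoDivisor.IsQuasistable.pushforward`), so `b_Q` is `ψ` plus the number of
coordinates of `Q` at sources, less the indicator of a set `F_Q ⊆ 𝓔` (`IsFlow.bNum_eq`). As `ψ` is
common to all `Q`, on a non-loop edge `a + b` depends on `Q` only through `F_Q`, which gives part 1.
For part 2, the sets `F_Q` mixed edge by edge according to `j` form one subset of `𝓔`; sliding along
it is again quasistable, and the middle term is the degree on `W` of the resulting divisor minus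
`μ(W)`. -/

namespace OrientedGraph

/-! ### Quasistable divisors: uniqueness and sliding of exceptional vertices. -/

variable {V E : Type*}

theorem sum_sum_fiber [Fintype E] [DecidableEq V] {R : Type*} [AddCommMonoid R] (W : Finset V)
    (ρ : E → V) (g : E → R) :
    ∑ v ∈ W, ∑ e with ρ e = v, g e = ∑ e, if ρ e ∈ W then g e else 0 := by
  simp_rw [sum_filter]
  rw [sum_comm]
  simp

theorem sum_bdry [Fintype E] [DecidableEq V] (Γ : OrientedGraph V E) (φ : E → ℤ) (W : Finset V) :
    ∑ v ∈ W, Γ.bdry φ v =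
      ∑ e, ((if Γ.tgt e ∈ W then φ e else 0) - if Γ.src e ∈ W then φ e else 0) := by
  simp only [bdry, sum_sub_distrib, sum_sum_fiber]

theorem sum_mul_diff [Fintype V] [Fintype E] [DecidableEq V] (Γ : OrientedGraph V E) (φ : E → ℤ)
    (m : V → ℝ) :
    ∑ e, (φ e : ℝ) * (m (Γ.tgt e) - m (Γ.src e)) = ∑ v, m v * (Γ.bdry φ v : ℝ) := by
  have key (ρ : E → V) : ∑ v, m v * ∑ e with ρ e = v, (φ e : ℝ) = ∑ e, (φ e : ℝ) * m (ρ e) := by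
    simp_rw [mul_sum]
    have := sum_sum_fiber univ ρ (fun e => (φ e : ℝ) * m (ρ e))
    simp only [mem_univ, if_true] at this
    rw [← this]
    refine sum_congr rfl fun v _ => sum_congr rfl fun e he => ?_
    rw [(mem_filter.1 he).2, mul_comm]
  simp only [bdry, Int.cast_sub, Int.cast_sum, mul_sub, sum_sub_distrib, key]

theorem bdry_sub [Fintype E] [DecidableEq V] (Γ : OrientedGraph V E) (φ ψ : E → ℤ) :
    Γ.bdry (φ - ψ) = Γ.bdry φ - Γ.bdry ψ := by
  ext v
  simp only [bdry, Pi.sub_apply, sum_sub_distrib]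
  ring

theorem diff_sub (Γ : OrientedGraph V E) (m m' : V → ℤ) :
    Γ.diff (m - m') = Γ.diff m - Γ.diff m' := by
  ext e
  simp only [diff, Pi.sub_apply]
  ring

theorem cut_compl [Fintype V] [Fintype E] [DecidableEq V] (Γ : OrientedGraph V E) (W : Finset V) :
    Γ.cut Wᶜ = Γ.cut W := by
  simp only [cut, mem_compl, not_iff_not]

theorem beta_add_beta_compl [Fintype V] [Fintype E] [DecidableEq V] (Γ : OrientedGraph V E)
    {μ : V → ℝ} {D : V → ℤ} (h : ∑ v, (D v : ℝ) = ∑ v, μ v) (W : Finset V) :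
    Γ.beta μ D W + Γ.beta μ D Wᶜ = Γ.cut W := by
  have h1 := sum_add_sum_compl W (fun v => (D v : ℝ))
  have h2 := sum_add_sum_compl W μ
  simp only [beta, cut_compl]
  linarith

/-- Since `v₀` lies in `W` or in its complement, one of `β_D(W) ≥ 0` and `β_{D'}(Wᶜ) ≥ 0` is strict,
and `β_{D'}(W) + β_{D'}(Wᶜ) = δ_W`. -/
theorem IsQuasistable.beta_sub_beta_lt_cut [Fintype V] [Fintype E] [DecidableEq V]
    {Γ : OrientedGraph V E} {v₀ : V} {μ : V → ℝ} {D D' : V → ℤ} (h : Γ.IsQuasistable v₀ μ D)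
    (h' : Γ.IsQuasistable v₀ μ D') {W : Finset V} (hW : W.Nonempty) (hW' : W ≠ univ) :
    Γ.beta μ D' W - Γ.beta μ D W < Γ.cut W := by
  have hc : Wᶜ ≠ univ := by rwa [Ne, compl_eq_univ_iff, ← Ne, ← nonempty_iff_ne_empty]
  have e' := Γ.beta_add_beta_compl h'.1 W
  have h1 := h.2 W hW'
  have h2 := h'.2 Wᶜ hc
  by_cases hv : v₀ ∈ W
  · linarith [h1.2 hv, h2.1]
  · linarith [h1.1, h2.2 (mem_compl.2 hv)]

/-- Two quasistable divisors that are equivalent are so by a chain that is constant. -/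
theorem IsQuasistable.diff_eq [Fintype V] [Fintype E] [DecidableEq V]
    {Γ : OrientedGraph V E} {v₀ : V} {μ : V → ℝ} {D : V → ℤ} {m m' : V → ℤ}
    (h : Γ.IsQuasistable v₀ μ (D - Γ.bdry (Γ.diff m)))
    (h' : Γ.IsQuasistable v₀ μ (D - Γ.bdry (Γ.diff m'))) : Γ.diff m = Γ.diff m' := by
  rw [← sub_eq_zero, ← diff_sub]
  obtain ⟨w, -, hw⟩ := exists_max_image univ (m - m') ⟨v₀, mem_univ _⟩
  set M := m - m' with hM
  -- On the locus where `M` is maximal, every cut edge contributes at least 1 to the degree of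
  -- `∂δ(M)`, which therefore reaches `δ_W`, more than quasistability allows.
  set W : Finset V := {v | M v = M w} with hWdef
  have memW (v : V) : v ∈ W ↔ M v = M w := by simp [hWdef]
  have hle (v : V) : M v ≤ M w := hw v (mem_univ _)
  by_cases hW : W = univ
  · ext e
    have h1 := (memW (Γ.tgt e)).1 (hW ▸ mem_univ _)
    have h2 := (memW (Γ.src e)).1 (hW ▸ mem_univ _)
    simp [diff, h1, h2]
  · exfalso
    have hlt := h.beta_sub_beta_lt_cut h' ⟨w, (memW w).2 rfl⟩ hW
    have hsum := Γ.sum_bdry (Γ.diff M) W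
    have hge : (Γ.cut W : ℤ) ≤ ∑ v ∈ W, Γ.bdry (Γ.diff M) v := by
      rw [hsum, cut, card_filter, Nat.cast_sum]
      refine sum_le_sum fun e _ => ?_
      have h1 := hle (Γ.tgt e)
      have h2 := hle (Γ.src e)
      simp only [memW, diff]
      split_ifs <;> push_cast <;> omega
    have hge' : (Γ.cut W : ℝ) ≤ ∑ v ∈ W, (Γ.bdry (Γ.diff M) v : ℝ) := by exact_mod_cast hge
    rw [hM, diff_sub, bdry_sub] at hge'
    simp only [beta, Pi.sub_apply, Int.cast_sub, sum_sub_distrib] at hlt hge'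
    linarith

theorem qsFlow_eq [Fintype V] [Fintype E] [DecidableEq V]
    {Γ : OrientedGraph V E} {v₀ : V} {μ : V → ℝ} {D : V → ℤ} {m : V → ℤ}
    (h : Γ.IsQuasistable v₀ μ (D - Γ.bdry (Γ.diff m))) : Γ.qsFlow v₀ μ D = Γ.diff m := by
  have hex : ∃ m : V → ℤ, Γ.IsQuasistable v₀ μ (D - Γ.bdry (Γ.diff m)) := ⟨m, h⟩
  rw [qsFlow, dif_pos hex]
  exact hex.choose_spec.diff_eq h

/-- Moving every exceptional vertex of a pseudo-divisor to one of the ends of its edge. -/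
def PseudoDivisor.pushforward {Γ : OrientedGraph V E} [DecidableEq V] (P : Γ.PseudoDivisor)
    (ρ : E → V) : V → ℤ :=
  fun v => P.D (Sum.inl v) - #{e ∈ P.edges | ρ e = v}

/-- Of the two halves of a subdivided edge, the one towards `ρ e` is never cut, and the other is cut
exactly when `e` is. -/
theorem cut_subdivision [Fintype V] [Fintype E] [DecidableEq V] [DecidableEq E]
    (Γ : OrientedGraph V E) (𝓔 : Finset E) {ρ : E → V} (hρ : ∀ e, ρ e = Γ.src e ∨ ρ e = Γ.tgt e)
    (W : Finset V) :
    (Γ.subdivision 𝓔).cut (W.disjSum {e | ρ e.1 ∈ W}) = Γ.cut W := by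
  simp only [cut, card_filter]
  rw [Fintype.sum_sum_type, Fintype.sum_prod_type,
    ← Fintype.sum_subtype_add_sum_subtype (fun e => e ∈ 𝓔), add_comm]
  simp only [Fintype.sum_bool, subdivision, inl_mem_disjSum, inr_mem_disjSum, mem_filter, mem_univ,
    true_and]
  congr 1
  refine sum_congr (by ext; simp) fun e _ => ?_
  rcases hρ e.1 with h | h <;> simp [h]

/-- Adding to `W` the exceptional vertices that slide into it gives a subset of the subdivision with
the same `β`, proper when `W` is. -/
theorem PseudoDivisor.IsQuasistable.pushforward [Fintype V] [Fintype E] [DecidableEq V]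
    [DecidableEq E] {Γ : OrientedGraph V E} {P : Γ.PseudoDivisor} {v₀ : V} {μ : V → ℝ}
    (hP : P.IsQuasistable v₀ μ) {ρ : E → V} (hρ : ∀ e, ρ e = Γ.src e ∨ ρ e = Γ.tgt e) :
    Γ.IsQuasistable v₀ μ (P.pushforward ρ) := by
  have hsum (W : Finset V) : ∑ v ∈ W, (P.pushforward ρ v : ℝ) =
      ∑ v ∈ W.disjSum {e : {e // e ∈ P.edges} | ρ e.1 ∈ W}, (P.D v : ℝ) := by
    have hcard : #{e : {e // e ∈ P.edges} | ρ e.1 ∈ W} = #{e ∈ P.edges | ρ e ∈ W} := by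
      rw [card_filter, card_filter, ← sum_coe_sort P.edges]
    have h := sum_card_fiberwise_eq_card_filter P.edges W ρ
    simp only [PseudoDivisor.pushforward, sum_disjSum, P.exceptional, Int.cast_sub,
      sum_sub_distrib, Int.cast_natCast]
    rw [← Nat.cast_sum, h, ← hcard]
    simp [sub_eq_add_neg]
  have hbeta (W : Finset V) : Γ.beta μ (P.pushforward ρ) W =
      (Γ.subdivision P.edges).beta (Sum.elim μ fun _ => 0) P.D
        (W.disjSum {e : {e // e ∈ P.edges} | ρ e.1 ∈ W}) := by
    rw [beta, beta, hsum, cut_subdivision Γ P.edges hρ]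
    simp [sum_disjSum]
  refine ⟨?_, fun W hW => ?_⟩
  · have h := hP.1
    rw [hsum]
    simpa using h
  · rw [hbeta]
    have hne : W.disjSum {e : {e // e ∈ P.edges} | ρ e.1 ∈ W} ≠ univ := by
      intro h
      refine hW (eq_univ_iff_forall.2 fun v => ?_)
      rw [← inl_mem_disjSum, h]
      exact mem_univ _
    have := hP.2 _ hne
    exact ⟨this.1, fun hv => this.2 (inl_mem_disjSum.2 hv)⟩

end OrientedGraph

/-! ### Relative interiors, and functions with integer slopes on the unit interval. -/

theorem Convex.lineMap_mem_intrinsicInterior {X : Type*} [AddCommGroup X] [Module ℝ X]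
    [TopologicalSpace X] [IsTopologicalAddGroup X] [ContinuousSMul ℝ X] {s : Set X}
    (hs : Convex ℝ s) {y q : X} (hy : y ∈ intrinsicInterior ℝ s) (hq : q ∈ s) {t : ℝ}
    (ht : t ∈ Set.Ico (0 : ℝ) 1) : AffineMap.lineMap y q t ∈ intrinsicInterior ℝ s := by
  have ht' : 1 - t ≠ 0 := by linarith [ht.2]
  have hqs : q ∈ affineSpan ℝ s := subset_affineSpan ℝ s hq
  have hys : y ∈ affineSpan ℝ s := subset_affineSpan ℝ s (intrinsicInterior_subset hy)
  obtain ⟨y', hy', rfl⟩ := mem_intrinsicInterior.1 hy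
  -- The dilation centred at `q` of ratio `1 / (1 - t)` sends the point in question to `y`; points
  -- that it sends into `s` lie in `s`, by convexity.
  let g : affineSpan ℝ s → affineSpan ℝ s := fun w =>
    ⟨AffineMap.lineMap q (w : X) (1 - t)⁻¹, AffineMap.lineMap_mem _ hqs w.2⟩
  have hg : Continuous g := by
    refine Continuous.subtype_mk ?_ _
    simp only [AffineMap.lineMap_apply_module]
    fun_prop
  let z : affineSpan ℝ s := ⟨AffineMap.lineMap (y' : X) q t, AffineMap.lineMap_mem _ hys hqs⟩
  have hgz : g z = y' := by
    apply Subtype.ext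
    simp only [g, z, AffineMap.lineMap_apply_module, smul_add, smul_smul]
    rw [inv_mul_cancel₀ ht', add_left_comm, ← add_smul]
    have : 1 - (1 - t)⁻¹ + (1 - t)⁻¹ * t = 0 := by field_simp; ring
    rw [this]
    simp
  refine mem_intrinsicInterior.2 ⟨z, mem_interior_iff_mem_nhds.2 ?_, rfl⟩
  have hn : g ⁻¹' ((↑) ⁻¹' s) ∈ nhds z :=
    hg.continuousAt.preimage_mem_nhds (by rw [hgz]; exact mem_interior_iff_mem_nhds.1 hy')
  filter_upwards [hn] with w hw
  have h1 : (1 - t) • (g w : X) + t • q ∈ s :=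
    hs hw hq (by linarith [ht.2]) ht.1 (by ring)
  have h2 : (1 - t) • (g w : X) + t • q = w := by
    simp only [g, AffineMap.lineMap_apply_module, smul_add, smul_smul]
    rw [mul_inv_cancel₀ ht', one_smul, add_right_comm, ← add_smul]
    have : (1 - t) * (1 - (1 - t)⁻¹) + t = 0 := by field_simp; ring
    rw [this]
    simp
  rwa [h2] at h1

/-- A function on `[0,1]` whose one-sided germs are linear with integer slopes, without break points
in the interior, is affine. -/
theorem exists_slope_of_slopes_eq {h : ℝ → ℝ} {sL sR : ℝ → ℤ}
    (hL : ∀ x ∈ Set.Ioc (0 : ℝ) 1, ∀ᶠ y in nhdsWithin x (Set.Iio x), h y = h x + sL x * (y - x))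
    (hR : ∀ x ∈ Set.Ico (0 : ℝ) 1, ∀ᶠ y in nhdsWithin x (Set.Ioi x), h y = h x + sR x * (y - x))
    (hLR : ∀ x ∈ Set.Ioo (0 : ℝ) 1, sL x = sR x) :
    h 1 - h 0 = sR 0 ∧ sL 1 = sR 0 := by
  have aff (a : ℝ) (x : ℝ) (c : ℤ) : HasDerivAt (fun y => a + (c : ℝ) * (y - x)) c x := by
    simpa using (((hasDerivAt_id x).sub_const x).const_mul (c : ℝ)).const_add a
  have dL : ∀ x ∈ Set.Ioc (0 : ℝ) 1, HasDerivWithinAt h (sL x) (Set.Iio x) x := fun x hx =>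
    (aff (h x) x (sL x)).hasDerivWithinAt.congr_of_eventuallyEq (hL x hx) (by simp)
  have dR : ∀ x ∈ Set.Ico (0 : ℝ) 1, HasDerivWithinAt h (sR x) (Set.Ioi x) x := fun x hx =>
    (aff (h x) x (sR x)).hasDerivWithinAt.congr_of_eventuallyEq (hR x hx) (by simp)
  have d : ∀ x ∈ Set.Ioo (0 : ℝ) 1, HasDerivAt h (sR x) x := fun x hx => by
    have h1 := dL x ⟨hx.1, hx.2.le⟩
    rw [hLR x hx] at h1
    have := h1.Iic_of_Iio.union (dR x ⟨hx.1.le, hx.2⟩).Ici_of_Ioi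
    rwa [Set.Iic_union_Ici, hasDerivWithinAt_univ] at this
  have hconst : ∀ x ∈ Set.Ioo (0 : ℝ) 1, ∀ y ∈ Set.Ioo (0 : ℝ) 1, sR x ≤ sR y := by
    intro x hx y hy
    by_contra hlt
    push Not at hlt
    -- By Darboux, a derivative with two distinct integer values would also take a half-integer
    -- value in between.
    have ho := Set.ordConnected_Ioo.image_hasDerivWithinAt (s := Set.Ioo (0 : ℝ) 1)
      (f' := fun x => (sR x : ℝ)) (fun x hx => (d x hx).hasDerivWithinAt)
    have hmem : ((sR y : ℝ) + 1 / 2) ∈ (fun x => (sR x : ℝ)) '' Set.Ioo (0 : ℝ) 1 := by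
      refine ho.out ⟨y, hy, rfl⟩ ⟨x, hx, rfl⟩ ⟨by norm_num, ?_⟩
      have : ((sR y + 1 : ℤ) : ℝ) ≤ sR x := by exact_mod_cast hlt
      push_cast at this
      linarith
    obtain ⟨z, -, hz⟩ := hmem
    have h1 : (2 * sR z : ℝ) = 2 * sR y + 1 := by simp only at hz; linarith
    have h2 : 2 * sR z = 2 * sR y + 1 := by exact_mod_cast h1
    omega
  have hmid : (1 / 2 : ℝ) ∈ Set.Ioo (0 : ℝ) 1 := by norm_num
  set c := sR (1 / 2) with hc
  have d' : ∀ x ∈ Set.Ioo (0 : ℝ) 1, HasDerivAt h c x := fun x hx => by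
    have : sR x = c := le_antisymm (hconst _ hx _ hmid) (hconst _ hmid _ hx)
    exact this ▸ d x hx
  have hcont : ContinuousOn h (Set.Icc 0 1) := by
    intro x hx
    rcases hx.1.eq_or_lt with rfl | h0
    · exact (dR 0 (by norm_num)).Ici_of_Ioi.continuousWithinAt.mono Set.Icc_subset_Ici_self
    rcases hx.2.eq_or_lt with rfl | h1
    · exact (dL 1 (by norm_num)).Iic_of_Iio.continuousWithinAt.mono Set.Icc_subset_Iic_self
    · exact (d' x ⟨h0, h1⟩).continuousAt.continuousWithinAt
  have mv (a b : ℝ) (ha : 0 ≤ a) (hab : a < b) (hb : b ≤ 1) : h b - h a = c * (b - a) := by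
    obtain ⟨z, -, hz⟩ := exists_hasDerivAt_eq_slope h (fun _ => (c : ℝ)) hab
      (hcont.mono (Set.Icc_subset_Icc ha hb))
      (fun x hx => d' x ⟨ha.trans_lt hx.1, hx.2.trans_le hb⟩)
    field_simp [sub_ne_zero.2 hab.ne'] at hz
    linarith
  have h0 : sR 0 = c := by
    have e : ∀ᶠ y in nhdsWithin (0 : ℝ) (Set.Ioi 0), y ∈ Set.Ioo (0 : ℝ) 1 :=
      Ioo_mem_nhdsGT (by norm_num)
    obtain ⟨y, hy, hy'⟩ := ((hR 0 (by norm_num)).and e).exists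
    have h1 := mv 0 y le_rfl hy'.1 hy'.2.le
    have h2 : ((sR 0 : ℝ) - c) * y = 0 := by linear_combination h1 - hy
    have h3 := (mul_eq_zero.1 h2).resolve_right hy'.1.ne'
    exact_mod_cast sub_eq_zero.1 h3
  have h1 : sL 1 = c := by
    have e : ∀ᶠ y in nhdsWithin (1 : ℝ) (Set.Iio 1), y ∈ Set.Ioo (0 : ℝ) 1 :=
      Ioo_mem_nhdsLT (by norm_num)
    obtain ⟨y, hy, hy'⟩ := ((hL 1 (by norm_num)).and e).exists
    have h1 := mv y 1 hy'.1.le hy'.2 le_rfl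
    have h2 : ((sL 1 : ℝ) - c) * (1 - y) = 0 := by linear_combination h1 + hy
    have h3 := (mul_eq_zero.1 h2).resolve_right (by linarith [hy'.2])
    exact_mod_cast sub_eq_zero.1 h3
  refine ⟨?_, h1.trans h0.symm⟩
  have := mv 0 1 le_rfl one_pos le_rfl
  rw [h0]
  linarith

/-! ### Integral flows: closedness, uniqueness, finiteness. -/

namespace OrientedGraph

variable {V E : Type*}

/-- `ψ` is an integral flow from `P` to `Ddag` when the points of `P` and those of the box are all
regarded as interior points of their edges; `ψ e` is the slope at the source of `e`. -/
def IsFlow [DecidableEq V] [Fintype E] [DecidableEq E] {Γ : OrientedGraph V E} {d : ℕ}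
    (f : Fin d → E) (Ddag : V → ℤ) (P : Γ.PseudoDivisor) (ψ : E → ℤ) : Prop :=
  ∀ v, Ddag v - P.D (Sum.inl v) =
    (∑ e with Γ.tgt e = v, (ψ e + #{k | f k = e} - if e ∈ P.edges then 1 else 0)) -
      ∑ e with Γ.src e = v, ψ e

/-- The increment along `e` of a function with slope `ψ e` at the source of `e`, with a point of
order `-1` at distance `y k` from the source whenever `f k = e`, and with one of order `1` at
distance `x e` if `e ∈ 𝓔`. -/
def increment [DecidableEq E] {d : ℕ} (f : Fin d → E) (𝓔 : Finset E) (ψ : E → ℤ) (x : E → ℝ)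
    (y : Fin d → ℝ) (e : E) : ℝ :=
  ψ e + ∑ k with f k = e, (1 - y k) - if e ∈ 𝓔 then 1 - x e else 0

/-- The differential of real 0-chains. -/
def realDiff (Γ : OrientedGraph V E) : (V → ℝ) →ₗ[ℝ] (E → ℝ) where
  toFun m e := m (Γ.tgt e) - m (Γ.src e)
  map_add' m m' := by ext e; simp only [Pi.add_apply]; ring
  map_smul' c m := by ext e; simp only [Pi.smul_apply, smul_eq_mul, RingHom.id_apply]; ring

theorem sum_sum_edge [Fintype E] [DecidableEq V] [DecidableEq E] {d : ℕ} (f : Fin d → E)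
    (ρ : E → V) (g : Fin d → ℤ) (v : V) :
    ∑ e with ρ e = v, ∑ k with f k = e, g k = ∑ k, if ρ (f k) = v then g k else 0 := by
  rw [sum_sum_fiber]
  simp

/-- The coboundaries form a closed subspace, and projecting away the compact cube of the `x` is a
closed map. -/
theorem isClosed_setOf_increment [Finite V] [DecidableEq E] (Γ : OrientedGraph V E) {d : ℕ}
    (f : Fin d → E) (𝓔 : Finset E) (ψ : E → ℤ) :
    IsClosed {y : Fin d → ℝ | ∃ x : E → ℝ, (∀ e, x e ∈ Set.Icc (0 : ℝ) 1) ∧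
      increment f 𝓔 ψ x y ∈ LinearMap.range Γ.realDiff} := by
  have hcl : IsClosed ((LinearMap.range Γ.realDiff : Submodule ℝ (E → ℝ)) : Set (E → ℝ)) :=
    Submodule.closed_of_finiteDimensional _
  have hc : Continuous fun z : (E → Set.Icc (0 : ℝ) 1) × (Fin d → ℝ) =>
      increment f 𝓔 ψ (fun e => (z.1 e : ℝ)) z.2 := by
    refine continuous_pi fun e => ?_
    unfold increment
    split_ifs <;> fun_prop
  convert isClosedMap_snd_of_compactSpace _ (hcl.preimage hc) using 1
  ext y
  constructor
  · rintro ⟨x, hx, hm⟩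
    exact ⟨⟨fun e => ⟨x e, hx e⟩, y⟩, hm, rfl⟩
  · rintro ⟨⟨x, y'⟩, hm, rfl⟩
    exact ⟨fun e => x e, fun e => (x e).2, hm⟩

section Flow

variable [Fintype V] [DecidableEq V] [Fintype E] [DecidableEq E] {Γ : OrientedGraph V E} {d : ℕ}
  {f : Fin d → E} {Ddag : V → ℤ} {P : Γ.PseudoDivisor}

theorem IsFlow.sum_mul_realDiff {ψ ψ' : E → ℤ} (h : IsFlow f Ddag P ψ) (h' : IsFlow f Ddag P ψ')
    (m : V → ℝ) : ∑ e, ((ψ e - ψ' e : ℤ) : ℝ) * Γ.realDiff m e = 0 := by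
  have hb (v : V) : Γ.bdry (ψ - ψ') v = 0 := by
    have h1 := (h v).symm.trans (h' v)
    simp only [add_sub_assoc, sum_add_distrib] at h1
    simp only [bdry, Pi.sub_apply, sum_sub_distrib]
    linarith
  have := Γ.sum_mul_diff (ψ - ψ') m
  simpa [hb, realDiff] using this

theorem mul_add_nonneg_of_abs_lt_one (n : ℤ) {r : ℝ} (hr : |r| < 1) :
    0 ≤ (n : ℝ) * (n + r) ∧ ((n : ℝ) * (n + r) = 0 → n = 0) := by
  rw [abs_lt] at hr
  rcases lt_trichotomy n 0 with hn | rfl | hn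
  · have : (n : ℝ) ≤ -1 := by exact_mod_cast Int.le_sub_one_of_lt hn
    have hp : 0 < (n : ℝ) * (n + r) := mul_pos_of_neg_of_neg (by linarith) (by linarith)
    exact ⟨hp.le, fun h => absurd h hp.ne'⟩
  · simp
  · have : (1 : ℝ) ≤ n := by exact_mod_cast hn
    have hp : 0 < (n : ℝ) * (n + r) := mul_pos (by linarith) (by linarith)
    exact ⟨hp.le, fun h => absurd h hp.ne'⟩

/-- One closed and one open interval suffice for `|x e - x' e| < 1`; this asymmetry lets a limiting
flow be compared with one coming from the open cell. -/
theorem IsFlow.eq_of_increment {ψ ψ' : E → ℤ} (h : IsFlow f Ddag P ψ) (h' : IsFlow f Ddag P ψ')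
    {x x' : E → ℝ} (hx : ∀ e, x e ∈ Set.Icc (0 : ℝ) 1) (hx' : ∀ e, x' e ∈ Set.Ioo (0 : ℝ) 1)
    {y : Fin d → ℝ} (hm : increment f P.edges ψ x y ∈ LinearMap.range Γ.realDiff)
    (hm' : increment f P.edges ψ' x' y ∈ LinearMap.range Γ.realDiff) : ψ = ψ' := by
  obtain ⟨m, hm⟩ := Submodule.sub_mem _ hm hm'
  have hsum := h.sum_mul_realDiff h' m
  have hinc (e : E) : Γ.realDiff m e =
      ((ψ e - ψ' e : ℤ) : ℝ) + if e ∈ P.edges then x e - x' e else 0 := by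
    rw [hm]
    simp only [increment, Pi.sub_apply]
    split_ifs <;> push_cast <;> ring
  simp only [hinc] at hsum
  have habs (e : E) : |if e ∈ P.edges then x e - x' e else 0| < 1 := by
    split_ifs
    · rw [abs_lt]
      constructor <;> linarith [(hx e).1, (hx e).2, (hx' e).1, (hx' e).2]
    · simp
  rw [sum_eq_zero_iff_of_nonneg fun e _ => (mul_add_nonneg_of_abs_lt_one _ (habs e)).1] at hsum
  ext e
  exact sub_eq_zero.1 ((mul_add_nonneg_of_abs_lt_one _ (habs e)).2 (hsum e (mem_univ _)))

/-- With different `y` and `y'` the perturbation `r` is bounded only by `d + 1`. Still, the terms `φ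
(φ + r)` sum to zero and are bounded below, so none can be huge. Only the existence of a bound
matters. -/
theorem IsFlow.abs_sub_le {ψ ψ' : E → ℤ} (h : IsFlow f Ddag P ψ) (h' : IsFlow f Ddag P ψ')
    {x x' : E → ℝ} (hx : ∀ e, x e ∈ Set.Icc (0 : ℝ) 1) (hx' : ∀ e, x' e ∈ Set.Icc (0 : ℝ) 1)
    {y y' : Fin d → ℝ} (hy : ∀ k, y k ∈ Set.Icc (0 : ℝ) 1) (hy' : ∀ k, y' k ∈ Set.Icc (0 : ℝ) 1)
    (hm : increment f P.edges ψ x y ∈ LinearMap.range Γ.realDiff)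
    (hm' : increment f P.edges ψ' x' y' ∈ LinearMap.range Γ.realDiff) (e : E) :
    |ψ e - ψ' e| ≤ (Fintype.card E + 1) * (d + 1) := by
  obtain ⟨m, hm⟩ := Submodule.sub_mem _ hm hm'
  have hsum := h.sum_mul_realDiff h' m
  set r : E → ℝ := fun e => ∑ k with f k = e, (y' k - y k) +
    if e ∈ P.edges then x e - x' e else 0 with hr
  have hinc (e : E) : Γ.realDiff m e = ((ψ e - ψ' e : ℤ) : ℝ) + r e := by
    rw [hm]
    simp only [increment, Pi.sub_apply, hr, sum_sub_distrib]
    split_ifs <;> push_cast <;> ring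
  simp only [hinc] at hsum
  have habs (e : E) : |r e| ≤ d + 1 := by
    refine (abs_add_le _ _).trans (add_le_add ?_ ?_)
    · refine (abs_sum_le_sum_abs _ _).trans ((sum_le_sum (g := fun _ => (1 : ℝ)) fun k _ => ?_).trans
        ?_)
      · rw [abs_le]
        constructor <;> linarith [(hy k).1, (hy k).2, (hy' k).1, (hy' k).2]
      · simp only [sum_const, nsmul_eq_mul, mul_one]
        exact_mod_cast (card_le_univ _).trans (Fintype.card_fin d).le
    · split_ifs
      · rw [abs_le]
        constructor <;> linarith [(hx e).1, (hx e).2, (hx' e).1, (hx' e).2]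
      · simp
  set K : ℝ := d + 1 with hK
  have hKpos : 0 < K := by positivity
  have hlow (e : E) : -K ^ 2 ≤ ((ψ e - ψ' e : ℤ) : ℝ) * (((ψ e - ψ' e : ℤ) : ℝ) + r e) := by
    have := abs_le.1 (habs e)
    have h2 : r e ^ 2 ≤ K ^ 2 := sq_le_sq' this.1 this.2
    nlinarith [sq_nonneg (((ψ e - ψ' e : ℤ) : ℝ) + r e / 2), sq_nonneg K]
  by_contra hlt
  push Not at hlt
  have hlt' : (Fintype.card E + 1) * K < |((ψ e - ψ' e : ℤ) : ℝ)| := by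
    rw [hK]; exact_mod_cast hlt
  set φ : ℝ := ((ψ e - ψ' e : ℤ) : ℝ) with hφ
  have hbig : Fintype.card E * K ^ 2 < φ * (φ + r e) := by
    have h1 : |φ| * (|φ| - K) ≤ φ * (φ + r e) := by
      have h2 : -(φ * r e) ≤ |φ| * K := by
        calc -(φ * r e) ≤ |φ * r e| := neg_le_abs _
          _ = |φ| * |r e| := abs_mul _ _
          _ ≤ |φ| * K := mul_le_mul_of_nonneg_left (habs e) (abs_nonneg _)
      nlinarith [abs_mul_abs_self φ]
    have h3 : (Fintype.card E : ℝ) * K < |φ| - K := by linarith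
    have h4 : (0 : ℝ) ≤ Fintype.card E * K := by positivity
    have h5 : K < |φ| := by linarith
    nlinarith
  have hle : φ * (φ + r e) + ∑ e' ∈ univ.erase e, (-K ^ 2) ≤ 0 := by
    rw [← hsum, ← add_sum_erase _ _ (mem_univ e)]
    exact add_le_add le_rfl (sum_le_sum fun e' _ => hlow e')
  have hcard : ((#(univ.erase e) : ℕ) : ℝ) ≤ Fintype.card E := by
    exact_mod_cast card_le_univ _
  rw [sum_const, nsmul_eq_mul] at hle
  nlinarith [sq_nonneg K]

theorem finite_setOf_isFlow_increment :
    {ψ : E → ℤ | IsFlow f Ddag P ψ ∧ ∃ x : E → ℝ, ∃ y : Fin d → ℝ,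
      (∀ e, x e ∈ Set.Icc (0 : ℝ) 1) ∧ (∀ k, y k ∈ Set.Icc (0 : ℝ) 1) ∧
        increment f P.edges ψ x y ∈ LinearMap.range Γ.realDiff}.Finite := by
  rcases Set.eq_empty_or_nonempty {ψ : E → ℤ | IsFlow f Ddag P ψ ∧ ∃ x : E → ℝ,
      ∃ y : Fin d → ℝ, (∀ e, x e ∈ Set.Icc (0 : ℝ) 1) ∧ (∀ k, y k ∈ Set.Icc (0 : ℝ) 1) ∧
        increment f P.edges ψ x y ∈ LinearMap.range Γ.realDiff} with h | ⟨ψ₀, h₀, x₀, y₀, hx₀, hy₀, hm₀⟩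
  · rw [h]
    exact Set.finite_empty
  · refine (Set.finite_Icc (fun e => ψ₀ e - (Fintype.card E + 1) * (d + 1))
      (fun e => ψ₀ e + (Fintype.card E + 1) * (d + 1))).subset ?_
    rintro ψ ⟨h, x, y, hx, hy, hm⟩
    have := fun e => abs_le.1 (h.abs_sub_le h₀ hx hx₀ hy hy₀ hm hm₀ e)
    exact ⟨fun e => by linarith [this e], fun e => by linarith [this e]⟩

end Flow

/-! ### Slopes of rational functions on the tropical curve. -/

section Curve

variable (Γ : OrientedGraph V E)

theorem pt_eq_inner {e e' : E} {r : ℝ} {r' : Set.Ioo (0 : ℝ) 1} :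
    Γ.pt e r = .inner e' r' ↔ e = e' ∧ r = r' := by
  have hr := r'.2
  unfold pt
  split_ifs with h1 h2
  · simp [Subtype.ext_iff]
  · simp only [false_iff, not_and]
    rintro - rfl
    exact h1 hr
  · simp only [false_iff, not_and]
    rintro - rfl
    exact h1 hr

theorem pt_eq_vertex {e : E} {r : ℝ} (hr : r ∈ Set.Icc (0 : ℝ) 1) {v : V} :
    Γ.pt e r = .vertex v ↔ (Γ.src e = v ∧ r = 0) ∨ (Γ.tgt e = v ∧ r = 1) := by
  unfold pt
  rcases hr.1.eq_or_lt with rfl | h0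
  · simp
  rcases hr.2.eq_or_lt with rfl | h1
  · simp [h0.not_ge]
  · simp [h0, h1, h0.ne', h1.ne]

theorem eventually_hinge_left (a x : ℝ) : ∀ᶠ y in nhdsWithin x (Set.Iio x),
    max 0 (y - a) = max 0 (x - a) + ((if a < x then 1 else 0 : ℤ) : ℝ) * (y - x) := by
  by_cases h : a < x
  · filter_upwards [nhdsWithin_le_nhds (Ioi_mem_nhds h)] with y hy
    rw [max_eq_right (by linarith [Set.mem_Ioi.1 hy]), max_eq_right (by linarith), if_pos h]
    simp
  · filter_upwards [self_mem_nhdsWithin] with y hy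
    rw [max_eq_left (by linarith [Set.mem_Iio.1 hy]), max_eq_left (by linarith), if_neg h]
    simp

theorem eventually_hinge_right (a x : ℝ) : ∀ᶠ y in nhdsWithin x (Set.Ioi x),
    max 0 (y - a) = max 0 (x - a) + ((if a ≤ x then 1 else 0 : ℤ) : ℝ) * (y - x) := by
  by_cases h : a ≤ x
  · filter_upwards [self_mem_nhdsWithin] with y hy
    rw [max_eq_right (by linarith [Set.mem_Ioi.1 hy]), max_eq_right (by linarith), if_pos h]
    simp
  · push Not at h
    filter_upwards [nhdsWithin_le_nhds (Iio_mem_nhds h)] with y hy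
    rw [max_eq_left (by linarith [Set.mem_Iio.1 hy]), max_eq_left (by linarith),
      if_neg (not_le.2 h)]
    simp

/-- The slopes at the ends of an edge of a rational function whose divisor has, in the interior of
the edge, coefficient `-1` at the points `y k` and coefficient `1` at the points `x j`. -/
theorem RatFun.exists_slope {Γ : OrientedGraph V E} (g : Γ.RatFun) (e : E) {ι κ : Type*}
    (s : Finset ι) (y : ι → ℝ) (t : Finset κ) (x : κ → ℝ)
    (h : ∀ r ∈ Set.Ioo (0 : ℝ) 1, g.slopeL e r - g.slopeR e r =
      -(∑ k ∈ s, if y k = r then 1 else 0) + ∑ j ∈ t, if x j = r then 1 else 0)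
    (hy : ∀ k ∈ s, y k ∈ Set.Icc (0 : ℝ) 1) (hx : ∀ j ∈ t, x j ∈ Set.Ioo (0 : ℝ) 1) :
    ∃ c : ℤ, g.slopeR e 0 = c + (∑ k ∈ s, if y k = 0 then 1 else 0) ∧
      g.slopeL e 1 = c + #s - (∑ k ∈ s, if y k = 1 then 1 else 0) - #t ∧
      g.toFun (Γ.pt e 1) - g.toFun (Γ.pt e 0) =
        c + ∑ k ∈ s, (1 - y k) - ∑ j ∈ t, (1 - x j) := by
  have hsplit (a r : ℝ) : (if a ≤ r then 1 else 0 : ℤ) =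
      (if a < r then 1 else 0) + if a = r then 1 else 0 := by
    rcases lt_trichotomy a r with h | h | h
    · simp [h, h.le, h.ne]
    · simp [h]
    · simp [h.not_ge, h.not_gt, h.ne']
  -- Subtracting a hinge for each point of order `-1` and adding one for each point of order `1`
  -- removes all interior break points.
  have key := exists_slope_of_slopes_eq
    (h := fun r => g.toFun (Γ.pt e r) - ∑ k ∈ s, max 0 (r - y k) + ∑ j ∈ t, max 0 (r - x j))
    (sL := fun r => g.slopeL e r - (∑ k ∈ s, if y k < r then 1 else 0) +
      ∑ j ∈ t, if x j < r then 1 else 0)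
    (sR := fun r => g.slopeR e r - (∑ k ∈ s, if y k ≤ r then 1 else 0) +
      ∑ j ∈ t, if x j ≤ r then 1 else 0) ?_ ?_ ?_
  -- Discounting the hinges with `y k = 0` treats those points as lying just after the source.
  · refine ⟨g.slopeR e 0 - (∑ k ∈ s, if y k = 0 then 1 else 0), by ring, ?_, ?_⟩
    · have hk := key.2
      have e1 : (∑ k ∈ s, if y k < 1 then 1 else 0 : ℤ) =
          #s - ∑ k ∈ s, if y k = 1 then 1 else 0 := by
        rw [card_eq_sum_ones, Nat.cast_sum, eq_sub_iff_add_eq, ← sum_add_distrib]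
        refine sum_congr rfl fun k hk => ?_
        rw [← hsplit, if_pos (hy k hk).2]
        simp
      have e2 : (∑ j ∈ t, if x j < 1 then 1 else 0 : ℤ) = #t := by
        rw [sum_congr rfl fun j hj => if_pos (hx j hj).2]
        simp
      have e3 : (∑ k ∈ s, if y k ≤ 0 then 1 else 0 : ℤ) = ∑ k ∈ s, if y k = 0 then 1 else 0 :=
        sum_congr rfl fun k hk => by rw [hsplit, if_neg (not_lt.2 (hy k hk).1), zero_add]
      have e4 : (∑ j ∈ t, if x j ≤ 0 then 1 else 0 : ℤ) = 0 :=
        sum_eq_zero fun j hj => if_neg (not_le.2 (hx j hj).1)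
      rw [e1, e2, e3, e4] at hk
      linarith
    · have hk := key.1
      have e1 : ∑ k ∈ s, max 0 (1 - y k) = ∑ k ∈ s, (1 - y k) :=
        sum_congr rfl fun k hk => max_eq_right (by linarith [(hy k hk).2])
      have e2 : ∑ j ∈ t, max 0 (1 - x j) = ∑ j ∈ t, (1 - x j) :=
        sum_congr rfl fun j hj => max_eq_right (by linarith [(hx j hj).2])
      have e3 : ∑ k ∈ s, max 0 (0 - y k) = 0 :=
        sum_eq_zero fun k hk => max_eq_left (by linarith [(hy k hk).1])
      have e4 : ∑ j ∈ t, max 0 (0 - x j) = 0 :=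
        sum_eq_zero fun j hj => max_eq_left (by linarith [(hx j hj).1])
      have e5 : (∑ k ∈ s, if y k ≤ 0 then 1 else 0 : ℤ) = ∑ k ∈ s, if y k = 0 then 1 else 0 :=
        sum_congr rfl fun k hk => by rw [hsplit, if_neg (not_lt.2 (hy k hk).1), zero_add]
      have e6 : (∑ j ∈ t, if x j ≤ 0 then 1 else 0 : ℤ) = 0 :=
        sum_eq_zero fun j hj => if_neg (not_le.2 (hx j hj).1)
      simp only [e1, e2, e3, e4, e5, e6] at hk
      push_cast at hk ⊢
      linarith
  · intro r hr
    filter_upwards [g.eq_left e r hr,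
      (Filter.eventually_all_finset s).2 fun k _ => eventually_hinge_left (y k) r,
      (Filter.eventually_all_finset t).2 fun j _ => eventually_hinge_left (x j) r] with z h1 h2 h3
    rw [h1, sum_congr rfl h2, sum_congr rfl h3, sum_add_distrib, sum_add_distrib, ← sum_mul,
      ← sum_mul]
    push_cast
    ring
  · intro r hr
    filter_upwards [g.eq_right e r hr,
      (Filter.eventually_all_finset s).2 fun k _ => eventually_hinge_right (y k) r,
      (Filter.eventually_all_finset t).2 fun j _ => eventually_hinge_right (x j) r] with z h1 h2 h3
    rw [h1, sum_congr rfl h2, sum_congr rfl h3, sum_add_distrib, sum_add_distrib, ← sum_mul,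
      ← sum_mul]
    push_cast
    ring
  · intro r hr
    have := h r hr
    simp only [hsplit, sum_add_distrib]
    linarith

end Curve

end OrientedGraph

/-! ### From the open cell to flows, and along segments to the vertices of the box. -/

namespace OrientedGraph

variable {V E : Type*} [Fintype V] [DecidableEq V] [Fintype E] [DecidableEq E]
  {Γ : OrientedGraph V E} {d : ℕ} {f : Fin d → E} {Ddag : V → ℤ} {P : Γ.PseudoDivisor}

omit [DecidableEq V] [Fintype E] [DecidableEq E] in
open Classical in
theorem divisorOnCurve_apply (D : V → ℤ) (p : Γ.Point) :
    Γ.divisorOnCurve D p = ∑ v, if Point.vertex v = p then D v else 0 := by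
  simp [divisorOnCurve, Finsupp.finsetSum_apply, Finsupp.single_apply]

/-- The coefficient of a box point at a vertex cancels against the slope correction made by counting
it as interior, so the flow equation has the same form on the boundary of the box. -/
theorem exists_flow_of_tropAbel_mem {y : Fin d → ℝ} (hy : ∀ k, y k ∈ Set.Icc (0 : ℝ) 1)
    (hcell : Γ.tropAbel Ddag (Γ.boxPoint f y) ∈ P.openCell) :
    ∃ (ψ : E → ℤ) (x : E → ℝ), IsFlow f Ddag P ψ ∧ (∀ e, x e ∈ Set.Ioo (0 : ℝ) 1) ∧
      increment f P.edges ψ x y ∈ LinearMap.range Γ.realDiff := by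
  classical
  obtain ⟨x₀, hx₀, heq⟩ := hcell
  obtain ⟨x, hx, hxx⟩ : ∃ x : E → ℝ, (∀ e, x e ∈ Set.Ioo (0 : ℝ) 1) ∧
      ∀ e : {e // e ∈ P.edges}, x₀ e = x e := by
    -- Values off `𝓔` never enter; `1 / 2` only keeps them in the open interval.
    refine ⟨fun e => if h : e ∈ P.edges then x₀ ⟨e, h⟩ else 1 / 2, fun e => ?_, fun e => by simp⟩
    dsimp only
    split_ifs
    · exact hx₀ _
    · norm_num
  obtain ⟨g, hg⟩ := QuotientAddGroup.eq.1 heq.symm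
  have hdiv : P.divisorAt x₀ = Γ.divisorOnCurve (fun v => P.D (Sum.inl v)) +
      ∑ e ∈ P.edges, Finsupp.single (Γ.pt e (x e)) (-1) := by
    rw [PseudoDivisor.divisorAt, ← sum_coe_sort P.edges]
    simp only [P.exceptional, hxx]
  have hval (p : Γ.Point) : g.ord p = (∑ v, if Point.vertex v = p then Ddag v else 0) -
      (∑ k, if Γ.pt (f k) (y k) = p then 1 else 0) -
      (∑ v, if Point.vertex v = p then P.D (Sum.inl v) else 0) +
      ∑ e ∈ P.edges, if Γ.pt e (x e) = p then 1 else 0 := by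
    rw [← hg, hdiv]
    simp only [Finsupp.add_apply, Finsupp.neg_apply, Finsupp.sub_apply, divisorOnCurve_apply,
      Finsupp.finsetSum_apply, Finsupp.single_apply, boxPoint]
    have h1 (e : E) : (if Γ.pt e (x e) = p then (-1 : ℤ) else 0) =
        -if Γ.pt e (x e) = p then 1 else 0 := by split_ifs <;> simp
    simp only [h1, sum_neg_distrib]
    ring
  have hslope (e : E) : ∃ c : ℤ, g.slopeR e 0 = c + (∑ k with f k = e, if y k = 0 then 1 else 0) ∧
      g.slopeL e 1 = c + #{k | f k = e} - (∑ k with f k = e, if y k = 1 then 1 else 0) -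
        #{e' ∈ P.edges | e' = e} ∧
      g.toFun (Γ.pt e 1) - g.toFun (Γ.pt e 0) =
        c + ∑ k with f k = e, (1 - y k) - ∑ e' ∈ P.edges with e' = e, (1 - x e') := by
    refine g.exists_slope e _ y _ x (fun r hr => ?_) (fun k _ => hy k) (fun j _ => hx j)
    have h := hval (.inner e ⟨r, hr⟩)
    simp only [pt_eq_inner, reduceCtorEq, if_false, sum_const_zero] at h
    simp only [RatFun.ord, ite_and] at h
    simp only [sum_filter]
    linarith
  choose ψ h0 h1 hinc using hslope
  refine ⟨ψ, x, fun v => ?_, hx, fun v => g.toFun (.vertex v), ?_⟩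
  · have h := hval (.vertex v)
    have hx' (e : E) : Γ.pt e (x e) ≠ .vertex v := by
      rw [Ne, Γ.pt_eq_vertex ⟨(hx e).1.le, (hx e).2.le⟩]
      have h1 := (hx e).1.ne'
      have h2 := (hx e).2.ne
      tauto
    have hy' (k : Fin d) : (if Γ.pt (f k) (y k) = .vertex v then 1 else 0 : ℤ) =
        (if Γ.src (f k) = v then if y k = 0 then 1 else 0 else 0) +
          if Γ.tgt (f k) = v then if y k = 1 then 1 else 0 else 0 := by
      rw [← ite_and, ← ite_and]
      simp only [Γ.pt_eq_vertex (hy k)]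
      by_cases h0 : y k = 0 <;> by_cases h1 : y k = 1 <;> simp_all
    simp only [hx', if_false, sum_const_zero, hy', sum_add_distrib, ← sum_sum_edge, RatFun.ord,
      h0, h1, Point.vertex.injEq, sum_ite_eq', mem_univ, if_true] at h
    have hcard (e : E) : (#{e' ∈ P.edges | e' = e} : ℤ) = if e ∈ P.edges then 1 else 0 := by
      rw [filter_eq']
      split_ifs <;> simp
    simp only [sum_sub_distrib, sum_add_distrib, hcard] at h ⊢
    linarith
  · ext e
    have h := hinc e
    have hs : ∑ e' ∈ P.edges with e' = e, (1 - x e') = if e ∈ P.edges then 1 - x e else 0 := by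
      rw [filter_eq']
      split_ifs <;> simp
    rw [hs] at h
    rw [increment, ← h]
    simp [realDiff, pt, not_le.2 (zero_lt_one (α := ℝ))]

theorem IsFlow.exists_increment_of_path {ψ : E → ℤ} (hψ : IsFlow f Ddag P ψ) {x : E → ℝ}
    (hx : ∀ e, x e ∈ Set.Ioo (0 : ℝ) 1) {γ : ℝ → Fin d → ℝ} (hγ : Continuous γ)
    (hbox : ∀ t ∈ Set.Ico (0 : ℝ) 1, ∀ k, γ t k ∈ Set.Icc (0 : ℝ) 1)
    (hcell : ∀ t ∈ Set.Ico (0 : ℝ) 1, Γ.tropAbel Ddag (Γ.boxPoint f (γ t)) ∈ P.openCell)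
    (hm : increment f P.edges ψ x (γ 0) ∈ LinearMap.range Γ.realDiff) :
    ∃ x : E → ℝ, (∀ e, x e ∈ Set.Icc (0 : ℝ) 1) ∧
      increment f P.edges ψ x (γ 1) ∈ LinearMap.range Γ.realDiff := by
  set C : (E → ℤ) → Set ℝ := fun ψ' => γ ⁻¹' {y | ∃ x : E → ℝ, (∀ e, x e ∈ Set.Icc (0 : ℝ) 1) ∧
      increment f P.edges ψ' x y ∈ LinearMap.range Γ.realDiff} with hC
  have hclosed (ψ' : E → ℤ) : IsClosed (C ψ') :=
    (isClosed_setOf_increment Γ f P.edges ψ').preimage hγ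
  have hfin := finite_setOf_isFlow_increment (Γ := Γ) (f := f) (Ddag := Ddag) (P := P)
  set F : Set (E → ℤ) := _ with hF
  change F.Finite at hfin
  have hopen (t : ℝ) (ht : t ∈ Set.Ico (0 : ℝ) 1) : ∃ ψ', IsFlow f Ddag P ψ' ∧ ψ' ∈ F ∧ t ∈ C ψ' ∧
      ∀ ψ'', IsFlow f Ddag P ψ'' → t ∈ C ψ'' → ψ'' = ψ' := by
    obtain ⟨ψ', x', h', hx', hm'⟩ := exists_flow_of_tropAbel_mem (hbox t ht) (hcell t ht)
    have hx'' := fun e => Set.Ioo_subset_Icc_self (hx' e)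
    refine ⟨ψ', h', ⟨h', x', γ t, hx'', hbox t ht, hm'⟩, ⟨x', hx'', hm'⟩, ?_⟩
    rintro ψ'' h'' ⟨x'', hx2, hm''⟩
    exact h''.eq_of_increment h' hx2 hx' hm'' hm'
  have hsub : Set.Ico (0 : ℝ) 1 ⊆ C ψ := by
    by_contra hnot
    obtain ⟨t, ht, htC⟩ := Set.not_subset.1 hnot
    have hcover (t : ℝ) (ht : t ∈ Set.Ico (0 : ℝ) 1) (h : t ∉ C ψ) : t ∈ ⋃ ψ' ∈ F \ {ψ}, C ψ' := by
      obtain ⟨ψ', -, hF', hC', -⟩ := hopen t ht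
      exact Set.mem_biUnion ⟨hF', fun he => h (he ▸ hC')⟩ hC'
    -- If `C ψ` missed a point of `[0,1)`, connectedness would make it meet the finite union of the
    -- other closed sets, against uniqueness of the flow.
    obtain ⟨z, hz, hz1, hz2⟩ := isPreconnected_closed_iff.1 isPreconnected_Ico (C ψ)
      (⋃ ψ' ∈ F \ {ψ}, C ψ') (hclosed ψ)
      (hfin.sdiff.isClosed_biUnion fun _ _ => hclosed _)
      (fun t ht => or_iff_not_imp_left.2 (hcover t ht))
      ⟨0, by norm_num, x, fun e => Set.Ioo_subset_Icc_self (hx e), hm⟩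
      ⟨t, ht, hcover t ht htC⟩
    obtain ⟨ψ', hψ', hzψ'⟩ := Set.mem_iUnion₂.1 hz2
    obtain ⟨ψ₁, -, -, -, huniq⟩ := hopen z hz
    exact hψ'.2 ((huniq ψ' hψ'.1.1 hzψ').trans (huniq ψ hψ hz1).symm)
  -- In the limit `x` may reach the boundary of the cube, so only the closed interval is claimed.
  have h1 : (1 : ℝ) ∈ closure (Set.Ico (0 : ℝ) 1) := by
    rw [closure_Ico (by norm_num)]
    norm_num
  exact closure_minimal hsub (hclosed ψ) h1

theorem floor_sub_floor_eq_or {a b x : ℝ} {n : ℤ} (h : b - a = n - (1 - x))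
    (hx : x ∈ Set.Icc (0 : ℝ) 1) : ⌊b⌋ - ⌊a⌋ = n ∨ ⌊b⌋ - ⌊a⌋ = n - 1 := by
  have h1 : ⌊b⌋ ≤ ⌊a + n⌋ := Int.floor_le_floor (by linarith [hx.2])
  have h2 : ⌊a + (n - 1 : ℤ)⌋ ≤ ⌊b⌋ := Int.floor_le_floor (by push_cast; linarith [hx.1])
  rw [Int.floor_add_intCast] at h1 h2
  omega

omit [Fintype V] in
theorem card_corner_eq (f : Fin d → E) (Q : Fin d → Bool) (v : V) :
    (#{k | Γ.corner f Q k = v} : ℤ) =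
      (∑ e with Γ.tgt e = v, (#{k | f k = e} - #{k | f k = e ∧ Q k = false} : ℤ)) +
        ∑ e with Γ.src e = v, (#{k | f k = e ∧ Q k = false} : ℤ) := by
  have h1 (e : E) : (#{k | f k = e} - #{k | f k = e ∧ Q k = false} : ℤ) =
      ∑ k with f k = e, if Q k then 1 else 0 := by
    rw [card_filter, card_filter, sum_filter, Nat.cast_sum, Nat.cast_sum, ← sum_sub_distrib]
    refine sum_congr rfl fun k _ => ?_
    cases Q k <;> simp
  have h2 (e : E) : (#{k | f k = e ∧ Q k = false} : ℤ) =
      ∑ k with f k = e, if Q k then 0 else 1 := by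
    rw [card_filter, sum_filter, Nat.cast_sum]
    refine sum_congr rfl fun k _ => ?_
    cases Q k <;> simp
  simp only [h1]
  simp only [h2, sum_sum_edge]
  rw [card_filter, Nat.cast_sum, ← sum_add_distrib]
  refine sum_congr rfl fun k _ => ?_
  unfold corner
  cases Q k <;> simp

omit [Fintype V] in
-- Sliding to the source instead of the target lowers the flow by one unit along the whole edge.
theorem IsFlow.pushforward_eq {ψ : E → ℤ} (hψ : IsFlow f Ddag P ψ) {F : Finset E}
    (hF : F ⊆ P.edges) (v : V) :
    P.pushforward (fun e => if e ∈ F then Γ.src e else Γ.tgt e) v = Ddag v -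
      (∑ e with Γ.tgt e = v, (ψ e + #{k | f k = e} - if e ∈ F then 1 else 0)) +
      ∑ e with Γ.src e = v, (ψ e - if e ∈ F then 1 else 0) := by
  have h := hψ v
  have hcard : (#{e ∈ P.edges | (if e ∈ F then Γ.src e else Γ.tgt e) = v} : ℤ) =
      (∑ e with Γ.tgt e = v, ((if e ∈ P.edges then 1 else 0) - if e ∈ F then 1 else 0)) +
        ∑ e with Γ.src e = v, if e ∈ F then 1 else 0 := by
    have hext (g : E → ℤ) : ∑ e ∈ P.edges, g e = ∑ e, if e ∈ P.edges then g e else 0 := by simp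
    rw [card_filter, Nat.cast_sum, hext, sum_filter, sum_filter, ← sum_add_distrib]
    refine sum_congr rfl fun e _ => ?_
    by_cases hF' : e ∈ F
    · simp [hF', hF hF']
    · by_cases he : e ∈ P.edges <;> simp [hF', he]
  rw [PseudoDivisor.pushforward, hcard]
  simp only [sum_sub_distrib] at h ⊢
  linarith

/-- Loops get a separate clause because there `a` does not see which end a coordinate takes. -/
theorem IsFlow.bNum_eq {v₀ : V} {μ : V → ℝ} (hP : P.IsQuasistable v₀ μ) {ψ : E → ℤ}
    (hψ : IsFlow f Ddag P ψ) {Q : Fin d → Bool} {x : E → ℝ}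
    (hx : ∀ e, x e ∈ Set.Icc (0 : ℝ) 1)
    (hm : increment f P.edges ψ x (vertexCoord Q) ∈ LinearMap.range Γ.realDiff) :
    ∃ F ⊆ P.edges, (∀ e, Γ.bNum f v₀ μ Ddag Q e =
      ψ e + #{k | f k = e ∧ Q k = false} - if e ∈ F then 1 else 0) ∧
      ∀ e, Γ.src e = Γ.tgt e → Γ.bNum f v₀ μ Ddag Q e = 0 := by
  obtain ⟨m, hm⟩ := hm
  set η : E → ℤ := fun e => ψ e + #{k | f k = e ∧ Q k = false} with hη
  have hinc (e : E) : m (Γ.tgt e) - m (Γ.src e) =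
      η e - if e ∈ P.edges then 1 - x e else 0 := by
    have h := congrFun hm e
    have hs : ∑ k with f k = e, (1 - vertexCoord Q k) = #{k | f k = e ∧ Q k = false} := by
      rw [sum_filter, card_filter, Nat.cast_sum]
      refine sum_congr rfl fun k _ => ?_
      unfold vertexCoord
      cases Q k <;> simp
    rw [increment, hs] at h
    simpa [realDiff, hη] using h
  -- Increments of `m` are integers up to a defect `1 - x e` in `[0,1]` on `𝓔`, so rounding down
  -- costs at most one unit, and only there; `F` collects the edges where it does.
  set M : V → ℤ := fun v => ⌊m v⌋ with hM
  set F : Finset E := {e | Γ.diff M e ≠ η e} with hFdef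
  have hdiff (e : E) : Γ.diff M e = η e ∨ (e ∈ P.edges ∧ Γ.diff M e = η e - 1) := by
    have h := hinc e
    by_cases he : e ∈ P.edges
    · rw [if_pos he] at h
      exact (floor_sub_floor_eq_or h (hx e)).imp_right fun h => ⟨he, h⟩
    · rw [if_neg he, sub_zero] at h
      left
      have h' : m (Γ.tgt e) = m (Γ.src e) + η e := by linarith
      simp [diff, hM, h']
  have hF : F ⊆ P.edges := by
    intro e he
    have he' : Γ.diff M e ≠ η e := (mem_filter.1 he).2
    exact ((hdiff e).resolve_left he').1
  have hMF (e : E) : Γ.diff M e = η e - if e ∈ F then 1 else 0 := by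
    by_cases he : Γ.diff M e = η e
    · simp [hFdef, he]
    · simp only [hFdef, mem_filter, mem_univ, true_and, he, not_false_eq_true, if_true, ne_eq]
      exact ((hdiff e).resolve_left he).2
  have hq : Ddag + Γ.divOf f Q - Γ.bdry (Γ.diff M) =
      P.pushforward fun e => if e ∈ F then Γ.src e else Γ.tgt e := by
    ext v
    rw [hψ.pushforward_eq hF]
    simp only [Pi.sub_apply, Pi.add_apply, divOf, bdry, hMF, card_corner_eq, hη, sum_sub_distrib,
      sum_add_distrib]
    ring
  have hqs : Γ.IsQuasistable v₀ μ (Ddag + Γ.divOf f Q - Γ.bdry (Γ.diff M)) := by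
    rw [hq]
    refine PseudoDivisor.IsQuasistable.pushforward hP fun e => ?_
    split_ifs <;> simp
  have hb (e : E) : Γ.bNum f v₀ μ Ddag Q e = Γ.diff M e := by
    rw [bNum, qsFlow_eq hqs]
  exact ⟨F, hF, fun e => (hb e).trans (hMF e), fun e he => by simp [hb, diff, he]⟩

end OrientedGraph

/-! ### One flow for all vertices of the polytope, and the theorem. -/

namespace OrientedGraph

variable {V E : Type*} [Fintype V] [DecidableEq V] [Fintype E] [DecidableEq E]
  {Γ : OrientedGraph V E} {d : ℕ} {f : Fin d → E} {Ddag : V → ℤ} {P : Γ.PseudoDivisor}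

omit [Fintype V] [DecidableEq V] [Fintype E] [DecidableEq E] in
theorem convexHull_vertexCoord_subset {ι : Type*} (Q : ι → Fin d → Bool) :
    convexHull ℝ (Set.range fun i => vertexCoord (Q i)) ⊆ Set.Icc 0 1 := by
  refine convexHull_min ?_ (convex_Icc _ _)
  rintro _ ⟨i, rfl⟩
  constructor <;> intro k <;> simp only [vertexCoord] <;> split_ifs <;> simp

omit [Fintype V] [Fintype E] in
theorem aSet_eq (Γ : OrientedGraph V E) (f : Fin d → E) (q : Fin d → Bool) (e : E) (W : Finset V) :
    (Γ.aSet f q e W : ℤ) =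
      (if Γ.tgt e ∈ W then 0 else (#{k | f k = e ∧ q k = true} : ℤ)) +
        if Γ.src e ∈ W then 0 else (#{k | f k = e ∧ q k = false} : ℤ) := by
  have hite (p : Prop) [Decidable p] (g : Fin d → ℤ) :
      (if p then 0 else ∑ k, g k) = ∑ k, if p then 0 else g k := by split_ifs <;> simp
  simp only [aSet, card_filter, Nat.cast_sum, hite, ← sum_add_distrib]
  refine sum_congr rfl fun k _ => ?_
  by_cases hk : f k = e
  · subst hk
    cases hq : q k <;> simp [corner, hq, ite_not]
  · simp [hk]

/-- A single flow computes `b_Q` up to the choice of a subset of the edges of the pseudo-divisor,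
for all the vertices `Q` of the polytope. -/
theorem exists_flow_forall_bNum_eq {v₀ : V} {μ : V → ℝ} (hP : P.IsQuasistable v₀ μ) {ι : Type*}
    [Nonempty ι] (Q : ι → Fin d → Bool)
    (hcell : (fun y => Γ.tropAbel Ddag (Γ.boxPoint f y)) ''
        intrinsicInterior ℝ (convexHull ℝ (Set.range fun i => vertexCoord (Q i))) ⊆ P.openCell) :
    ∃ ψ : E → ℤ, IsFlow f Ddag P ψ ∧ ∀ i, ∃ F ⊆ P.edges, (∀ e, Γ.bNum f v₀ μ Ddag (Q i) e =
      ψ e + #{k | f k = e ∧ Q i k = false} - if e ∈ F then 1 else 0) ∧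
      ∀ e, Γ.src e = Γ.tgt e → Γ.bNum f v₀ μ Ddag (Q i) e = 0 := by
  set K := convexHull ℝ (Set.range fun i => vertexCoord (Q i)) with hK
  have hconv : Convex ℝ K := convex_convexHull _ _
  have hne : K.Nonempty := (Set.range_nonempty _).convexHull
  obtain ⟨y, hy⟩ := hne.intrinsicInterior hconv
  have hbox (y) (hy : y ∈ intrinsicInterior ℝ K) (k : Fin d) : y k ∈ Set.Icc (0 : ℝ) 1 := by
    have h := convexHull_vertexCoord_subset Q (intrinsicInterior_subset hy)
    exact ⟨h.1 k, h.2 k⟩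
  have hcell' (y) (hy : y ∈ intrinsicInterior ℝ K) :
      Γ.tropAbel Ddag (Γ.boxPoint f y) ∈ P.openCell := hcell ⟨y, hy, rfl⟩
  obtain ⟨ψ, x, hψ, hx, hm⟩ := exists_flow_of_tropAbel_mem (hbox y hy) (hcell' y hy)
  refine ⟨ψ, hψ, fun i => ?_⟩
  have hseg (t : ℝ) (ht : t ∈ Set.Ico (0 : ℝ) 1) :
      AffineMap.lineMap y (vertexCoord (Q i)) t ∈ intrinsicInterior ℝ K :=
    hconv.lineMap_mem_intrinsicInterior hy (subset_convexHull _ _ ⟨i, rfl⟩) ht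
  obtain ⟨x', hx', hm'⟩ := hψ.exists_increment_of_path hx
    (γ := fun t => AffineMap.lineMap y (vertexCoord (Q i)) t) AffineMap.lineMap_continuous
    (fun t ht => hbox _ (hseg t ht)) (fun t ht => hcell' _ (hseg t ht)) (by simpa using hm)
  exact hψ.bNum_eq hP hx' (by simpa using hm')

end OrientedGraph

theorem theorem4p11 {V E : Type*} [Fintype V] [DecidableEq V] [Fintype E] [DecidableEq E]
    (Γ : OrientedGraph V E) (hΓ : Γ.Connected) (v₀ : V)
    (k : ℤ) (μ : V → ℝ) (hμ : ∑ v, μ v = (k : ℝ))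
    (d : ℕ) (Ddag : V → ℤ) (hDdag : ∑ v, Ddag v = k + d)
    (f : Fin d → E) (n : ℕ) (Q : Fin (n + 1) → Fin d → Bool)
    (P : Γ.PseudoDivisor) (hP : P.IsQuasistable v₀ μ)
    (hcell : (fun y => Γ.tropAbel Ddag (Γ.boxPoint f y)) ''
        intrinsicInterior ℝ
          (convexHull ℝ (Set.range fun i => OrientedGraph.vertexCoord (Q i))) ⊆ P.openCell) :
    (∀ (i j : Fin (n + 1)) (e : E),
      |(((Γ.aNum f (Q i) e (Γ.tgt e) : ℤ) + Γ.bNum f v₀ μ Ddag (Q i) e) -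
        ((Γ.aNum f (Q j) e (Γ.tgt e) : ℤ) + Γ.bNum f v₀ μ Ddag (Q j) e))| ≤ 1) ∧
    (∀ (j : E → Fin (n + 1)) (W : Finset V), v₀ ∈ W → W ≠ Finset.univ →
      -((Γ.cut W : ℝ) / 2) <
        (∑ v ∈ W, (Ddag v : ℝ)) - (∑ v ∈ W, μ v) - d +
          ∑ e, ((Γ.aSet f (Q (j e)) e W : ℝ) - (Γ.bSet f v₀ μ Ddag (Q (j e)) e W : ℝ)) ∧
      (∑ v ∈ W, (Ddag v : ℝ)) - (∑ v ∈ W, μ v) - d +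
          ∑ e, ((Γ.aSet f (Q (j e)) e W : ℝ) - (Γ.bSet f v₀ μ Ddag (Q (j e)) e W : ℝ)) ≤
        (Γ.cut W : ℝ) / 2) := by
  obtain ⟨ψ, hψ, h⟩ := OrientedGraph.exists_flow_forall_bNum_eq hP Q hcell
  choose F hF hb hloop using h
  have hcount (q : Fin d → Bool) (e : E) : #{k | f k = e} =
      #{k | f k = e ∧ q k = true} + #{k | f k = e ∧ q k = false} := by
    have := card_filter_add_card_filter_not (s := {k | f k = e}) (fun k => q k = true)
    simpa [filter_filter] using this.symm
  refine ⟨fun i j e => ?_, fun j W hv hW => ?_⟩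
  · by_cases he : Γ.src e = Γ.tgt e
    · have ha (q : Fin d → Bool) : Γ.aNum f q e (Γ.tgt e) = #{k | f k = e} := by
        unfold OrientedGraph.aNum
        congr 1
        ext k
        simp only [mem_filter, mem_univ, true_and, and_iff_left_iff_imp]
        rintro rfl
        simp [OrientedGraph.corner, he]
      simp [ha, hloop _ e he]
    · have ha (q : Fin d → Bool) : Γ.aNum f q e (Γ.tgt e) = #{k | f k = e ∧ q k = true} := by
        unfold OrientedGraph.aNum
        congr 1
        ext k
        simp only [mem_filter, mem_univ, true_and, and_congr_right_iff]
        rintro rfl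
        cases hq : q k <;> simp [OrientedGraph.corner, hq, he]
      -- Coordinates at the target and at the source add up to a number independent of `Q`, so `a +
      -- b` is a constant minus an indicator.
      have hi := hcount (Q i) e
      have hj := hcount (Q j) e
      rw [ha, ha, hb, hb, abs_le]
      split_ifs <;> constructor <;> omega
  -- The choice of vertex varies with the edge, but `G` is still a subset of `𝓔`, so a single
  -- quasistable divisor accounts for the mixed sum.
  · set G : Finset E := {e | e ∈ F (j e)} with hG
    have hGF (e : E) : e ∈ F (j e) ↔ e ∈ G := by simp [hG]
    have hGP : G ⊆ P.edges := fun e he => hF (j e) ((hGF e).2 he)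
    have hd : (d : ℤ) = ∑ e, (#{k | f k = e} : ℤ) := by
      have := card_eq_sum_card_fiberwise (s := (univ : Finset (Fin d))) (f := f) (t := univ)
        (fun _ _ => mem_univ _)
      rw [card_univ, Fintype.card_fin] at this
      exact_mod_cast this
    have hkey : ∑ v ∈ W, P.pushforward (fun e => if e ∈ G then Γ.src e else Γ.tgt e) v =
        ∑ v ∈ W, Ddag v - d +
          ∑ e, ((Γ.aSet f (Q (j e)) e W : ℤ) - Γ.bSet f v₀ μ Ddag (Q (j e)) e W) := by
      simp only [hψ.pushforward_eq hGP]
      rw [sum_add_distrib, sum_sub_distrib, OrientedGraph.sum_sum_fiber,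
        OrientedGraph.sum_sum_fiber, hd, sub_add, sub_add, ← sum_sub_distrib, ← sum_sub_distrib]
      congr 1
      refine sum_congr rfl fun e _ => ?_
      have hc := hcount (Q (j e)) e
      rw [OrientedGraph.aSet_eq, OrientedGraph.bSet, hb]
      simp only [hGF]
      by_cases ht : Γ.tgt e ∈ W <;> by_cases hs : Γ.src e ∈ W <;> simp [ht, hs] <;> omega
    have hqs := hP.pushforward (ρ := fun e => if e ∈ G then Γ.src e else Γ.tgt e) fun e => by
      split_ifs <;> simp
    have hkey' := congrArg (Int.cast : ℤ → ℝ) hkey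
    push_cast at hkey'
    have hc : Wᶜ ≠ univ := by
      rw [Ne, compl_eq_univ_iff]
      exact ne_empty_of_mem hv
    -- As `v₀ ∈ W`, the lower bound is strict, while the complement gives only a weak upper bound.
    have h1 := (hqs.2 W hW).2 hv
    have h2 := (hqs.2 Wᶜ hc).1
    have h3 := Γ.beta_add_beta_compl hqs.1 W
    rw [OrientedGraph.beta] at h1 h3
    constructor <;> linarith
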